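/- Let $\mathbb K$ be a field, let $n \ge 0$, let $a_1,\dots,a_n$ be positive integers, and let $A=(x_{i_1,\dots,i_n})_{1\le i_j\le a_j}$ be the generic $a_1\times\dots\times a_n$ table, whose entries are the variables of the polynomial ring $R=\mathbb K[x_{i_1,\dots,i_n}]$. For $\mathcal J\subseteq\{1,\dots,n\}$ the marginal table $A_{\mathcal J}$ is the table indexed by $(i_j)_{j\in\mathcal J}$ whose entry at $(i_j)_{j\in\mathcal J}$ is the sum of all entries of $A$ whose indices at the positions $j\in\mathcal J$ are the given $i_j$. For a table $B=(b_{i})$ with entries in $R$, indexed by tuples $i=(i_j)_{j \in \mathcal J}$, let $I(B)\subseteq R$ be the ideal generated by the generalized $2\times 2$ minors $$\det\begin{pmatrix} b_{i} & b_{k'}\\ b_{i'} & b_{k}\end{pmatrix},$$ for all index tuples $i,k$ and all coordinates $l \in \mathcal J$, where $i'$ is $i$ with its $l$-th coordinate replaced by $k_l$, and $k'$ is $k$ with its $l$-th coordinate replaced by $i_l$. For a collection $\Delta$ of subsets of $\{1,\dots,n\}$, let $$I_\Delta(A)=\sum_{\mathcal J\in\Delta} I(A_{\mathcal J})\subseteq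 R .$$ Theorem. If $\Delta$ is a simplicial complex (a collection of subsets of $\{1,\dots,n\}$ closed under taking subsets) with at most three facets (inclusion-maximal elements), then $I_\Delta(A)$ is a radical ideal. -/

import Mathlib

/-- The marginal table `A_J` of a table `A`: its entry at `s` is the sum of all entries of `A`
whose indices in `J` are prescribed by `s`. -/
def marginalTable {R : Type*} [CommRing R] {n : ℕ} {a : Fin n → ℕ}
    (A : ((j : Fin n) → Fin (a j)) → R) (J : Finset (Fin n)) :
    ((j : J) → Fin (a j)) → R :=
  fun s => ∑ i : (j : Fin n) → Fin (a j) with (∀ j : J, i j = s j), A i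

/-- The generalized `2 × 2` minor of the table `B` about the coordinate `l`, attached to the two
indices `i` and `k`: only the `l`-th coordinates of `i` and `k` are interchanged. -/
def tableMinor {R : Type*} [CommRing R] {ι : Type*} [DecidableEq ι] {b : ι → ℕ}
    (B : ((j : ι) → Fin (b j)) → R) (l : ι) (i k : (j : ι) → Fin (b j)) : R :=
  Matrix.det !![B i, B (Function.update k l (i l));
                B (Function.update i l (k l)), B k]

/-- The ideal `I(B)` generated by all generalized `2 × 2` minors of the table `B`. -/
def segreIdeal {R : Type*} [CommRing R] {ι : Type*} [DecidableEq ι] {b : ι → ℕ}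
    (B : ((j : ι) → Fin (b j)) → R) : Ideal R :=
  Ideal.span {f | ∃ (l : ι) (i k : (j : ι) → Fin (b j)), f = tableMinor B l i k}

/-- The `Δ`-independence ideal `I_Δ(A) = ∑_{J ∈ Δ} I(A_J)`. -/
def independenceIdeal {R : Type*} [CommRing R] {n : ℕ} {a : Fin n → ℕ}
    (Δ : Set (Finset (Fin n))) (A : ((j : Fin n) → Fin (a j)) → R) : Ideal R :=
  ⨆ J ∈ Δ, segreIdeal (marginalTable A J)

/-- The generic `a₁ × ⋯ × aₙ` table over `K`: its entries are distinct variables. -/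
noncomputable def genericTable (K : Type*) [Field K] {n : ℕ} (a : Fin n → ℕ) :
    ((j : Fin n) → Fin (a j)) → MvPolynomial ((j : Fin n) → Fin (a j)) K :=
  fun i => MvPolynomial.X i

/-- The facets of `Δ`: its maximal faces. -/
def facets {n : ℕ} (Δ : Set (Finset (Fin n))) : Set (Finset (Fin n)) :=
  {J | Maximal (fun F => F ∈ Δ) J}

/-!
Replacing, in each direction, the slice at `0` by the sum of all slices is an invertible linear
change of coordinates under which the entries of `A_J` become the variables indexed by the points
that vanish outside `J`. Hence `I_Δ(A)` becomes the ideal generated by the binomials `x y - x' y'`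
in which two points vanishing outside a common facet swap one coordinate. Such a binomial ideal is
the kernel of the map to the monoid algebra of the classes of multisets of points under swaps, and
the monoid algebra of a torsion-free commutative monoid over a reduced ring is reduced, so it
remains to see that `n s ∼ n t` implies `s ∼ t` for `n ≠ 0`.

Call a point an agent if it vanishes outside every facet. An agent can exchange a coordinate with
any point that vanishes outside some facet, and so lets any two such points interact. For at most
three facets, two multisets with agents are equivalent as soon as they have the same one-dimensional
margins, a condition that is torsion-free. Without agents, the multiset splits into parts that
belong to fewer facets and never interact, under swaps, in any of its multiples, and one argues by
the number of facets.
-/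

section ReducedMonoidAlgebra

lemma isJacobsonRing_of_jacobson_bot {R : Type*} [CommRing R] [Ring.DimensionLEOne R]
    (h : (⊥ : Ideal R).jacobson = ⊥) : IsJacobsonRing R := by
  refine isJacobsonRing_iff_prime_eq.2 fun P hP => ?_
  rcases eq_or_ne P ⊥ with rfl | hne
  · exact h
  · exact Ideal.jacobson_eq_self_of_isMaximal (H := hP.isMaximal hne)

lemma isJacobsonRing_int : IsJacobsonRing ℤ := by
  refine isJacobsonRing_of_jacobson_bot (eq_bot_iff.2 fun x hx => ?_)
  rcases Int.isUnit_iff.1 (Ideal.mem_jacobson_bot.1 hx x) with h | h <;>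
    exact Ideal.mem_bot.2 (by nlinarith)

lemma exists_prime_charP_of_finiteType_int (F : Type*) [Field F]
    [hF : Algebra.FiniteType ℤ F] :
    ∃ p, p.Prime ∧ CharP F p := by
  obtain ⟨p, hp⟩ := CharP.exists F
  refine ⟨p, (CharP.char_is_prime_or_zero F p).resolve_right ?_, hp⟩
  rintro rfl
  have := CharP.charP_to_charZero F
  have := isJacobsonRing_int
  have := finite_of_finite_type_of_isJacobsonRing ℤ F
  exact Int.not_isField (isField_of_isIntegral_of_isField
    (FaithfulSMul.algebraMap_injective ℤ F) (Field.toIsField F))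

variable {R M : Type*} [CommRing R]

lemma exists_finiteType_int_subalgebra_map_eq [AddMonoid M] (f : AddMonoidAlgebra R M) :
    ∃ A : Subalgebra ℤ R, Algebra.FiniteType ℤ A ∧
      ∃ g : AddMonoidAlgebra A M, AddMonoidAlgebra.mapRingHom M (A.val : A →+* R) g = f := by
  let A := Algebra.adjoin ℤ (f.coeff '' (f.coeff.support : Set M))
  have coeff_mem (m : M) : f.coeff m ∈ A := by
    by_cases hm : f.coeff m = 0
    · exact hm ▸ A.zero_mem
    · exact Algebra.subset_adjoin ⟨m, Finsupp.mem_support_iff.2 hm, rfl⟩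
  have hrange : f ∈ Set.range (AddMonoidAlgebra.map (A.val : A →+ R)) := by
    rw [AddMonoidAlgebra.range_map]
    exact fun m => ⟨⟨f.coeff m, coeff_mem m⟩, rfl⟩
  exact ⟨A, (Subalgebra.fg_iff_finiteType A).1
    (Subalgebra.fg_def.2 ⟨_, f.coeff.support.finite_toSet.image _, rfl⟩), hrange⟩

variable [AddCommMonoid M] [IsAddTorsionFree M]

lemma coeff_pow_char_pow_nsmul (p : ℕ) [Fact p.Prime] [CharP R p] (f : AddMonoidAlgebra R M)
    (k : ℕ) (m : M) : (f ^ p ^ k).coeff (p ^ k • m) = f.coeff m ^ p ^ k := by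
  classical
  nontriviality R
  have : CharP (AddMonoidAlgebra R M) p :=
    charP_of_injective_algebraMap (FaithfulSMul.algebraMap_injective R _) p
  have hp : p ^ k ≠ 0 := pow_ne_zero k (Fact.out : p.Prime).ne_zero
  induction f using AddMonoidAlgebra.induction_linear with
  | zero => simp [zero_pow hp]
  | add f g hf hg => simp [add_pow_char_pow, hf, hg]
  | single a r =>
    simp [AddMonoidAlgebra.single_pow, Finsupp.single_apply, nsmul_right_inj hp, ite_pow,
      zero_pow hp]

lemma isNilpotent_coeff_of_charP (p : ℕ) [Fact p.Prime] [CharP R p] {f : AddMonoidAlgebra R M}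
    (hf : IsNilpotent f) (m : M) : IsNilpotent (f.coeff m) := by
  obtain ⟨n, hn⟩ := hf
  refine ⟨p ^ n, ?_⟩
  rw [← coeff_pow_char_pow_nsmul,
    pow_eq_zero_of_le (Nat.lt_pow_self (Fact.out : p.Prime).one_lt).le hn]
  simp

/- Without a characteristic, replace `R` by the finitely generated subring of the coefficients: it
is Jacobson, so a coefficient in all of its maximal ideals is nilpotent, and its residue fields have
positive characteristic. -/
lemma isNilpotent_coeff {f : AddMonoidAlgebra R M} (hf : IsNilpotent f) (m : M) :
    IsNilpotent (f.coeff m) := by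
  obtain ⟨A, _, g, rfl⟩ := exists_finiteType_int_subalgebra_map_eq f
  have hinj : Function.Injective (AddMonoidAlgebra.mapRingHom M (A.val : A →+* R)) :=
    AddMonoidAlgebra.map_injective _ Subtype.val_injective
  have hg : IsNilpotent g := (IsNilpotent.map_iff hinj).1 hf
  suffices hmem : g.coeff m ∈ (⊥ : Ideal A).jacobson by
    have := isJacobsonRing_int
    have : IsJacobsonRing A := isJacobsonRing_of_finiteType (A := ℤ)
    rw [← Ideal.radical_eq_jacobson] at hmem
    simpa using (mem_nilradical.1 hmem).map A.val
  refine Ideal.mem_sInf.2 fun {I} ⟨_, hI⟩ => ?_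
  have hfin : Algebra.FiniteType ℤ (A ⧸ I) :=
    .of_surjective (Ideal.Quotient.mk I).toIntAlgHom Ideal.Quotient.mk_surjective
  let := Ideal.Quotient.field I
  obtain ⟨p, hp, _⟩ := exists_prime_charP_of_finiteType_int (A ⧸ I) (hF := hfin)
  have : Fact p.Prime := ⟨hp⟩
  have := isNilpotent_coeff_of_charP p
    (hg.map (AddMonoidAlgebra.mapRingHom M (Ideal.Quotient.mk I))) m
  simpa [Ideal.Quotient.eq_zero_iff_mem] using this.eq_zero

lemma isReduced_addMonoidAlgebra [IsReduced R] : IsReduced (AddMonoidAlgebra R M) :=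
  ⟨fun _ hf => AddMonoidAlgebra.coeff_eq_zero.1
    (Finsupp.ext fun m => (isNilpotent_coeff hf m).eq_zero)⟩

end ReducedMonoidAlgebra

section BinomialIdeal

open MvPolynomial

variable (R : Type*) [CommRing R] {σ : Type*}

/-- The monomial whose variables, counted with multiplicity, are the members of `s`. -/
noncomputable def multisetMonomial (s : Multiset σ) : MvPolynomial σ R := (s.map X).prod

/-- The ideal of differences of `c`-congruent monomials. -/
noncomputable def binomialIdeal (c : AddCon (Multiset σ)) : Ideal (MvPolynomial σ R) :=
  Ideal.span {f | ∃ s t, c s t ∧ f = multisetMonomial R s - multisetMonomial R t}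

/-- The map from polynomials to the monoid algebra of `c`-classes that sends a monomial to its
class. -/
noncomputable def monomialClassMap (c : AddCon (Multiset σ)) :
    MvPolynomial σ R →ₐ[R] AddMonoidAlgebra R c.Quotient :=
  aeval fun x => .single ({x} : Multiset σ) 1

variable {R}

lemma multisetMonomial_zero : multisetMonomial R (0 : Multiset σ) = 1 := by
  simp [multisetMonomial]

lemma multisetMonomial_singleton (x : σ) : multisetMonomial R {x} = X x := by
  simp [multisetMonomial]

lemma multisetMonomial_add (s t : Multiset σ) :
    multisetMonomial R (s + t) = multisetMonomial R s * multisetMonomial R t := by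
  simp [multisetMonomial]

lemma monomialClassMap_multisetMonomial (c : AddCon (Multiset σ)) (s : Multiset σ) :
    monomialClassMap R c (multisetMonomial R s) = .single (s : c.Quotient) 1 := by
  induction s using Multiset.induction_on with
  | empty => rw [multisetMonomial_zero, map_one, AddMonoidAlgebra.one_def, c.coe_zero]
  | cons x s ih =>
    rw [← Multiset.singleton_add, multisetMonomial_add, map_mul, ih, multisetMonomial_singleton,
      monomialClassMap, aeval_X, AddMonoidAlgebra.single_mul_single, one_mul, c.coe_add]

lemma ker_monomialClassMap (c : AddCon (Multiset σ)) :
    RingHom.ker (monomialClassMap R c) = binomialIdeal R c := by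
  refine le_antisymm (fun f hf => ?_) (Ideal.span_le.2 ?_)
  · let classMonomial : Multiset σ →+ Additive (MvPolynomial σ R ⧸ binomialIdeal R c) :=
      { toFun := fun s => .ofMul (Ideal.Quotient.mk _ (multisetMonomial R s))
        map_zero' := by rw [multisetMonomial_zero, map_one, ofMul_one]
        map_add' := fun s t => by rw [multisetMonomial_add, map_mul, ofMul_mul] }
    have hc : c ≤ AddCon.ker classMonomial := fun s t h =>
      congrArg Additive.ofMul (Ideal.Quotient.eq.2 (Ideal.subset_span ⟨s, t, h, rfl⟩))
    let retraction := AddMonoidAlgebra.lift R (MvPolynomial σ R ⧸ binomialIdeal R c) _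
      (AddMonoidHom.toMultiplicativeLeft (c.lift classMonomial hc))
    have hretraction : retraction.comp (monomialClassMap R c) = Ideal.Quotient.mkₐ R _ := by
      ext x
      simp [retraction, monomialClassMap, classMonomial, multisetMonomial_singleton]
    rw [← Ideal.Quotient.eq_zero_iff_mem, ← Ideal.Quotient.mkₐ_eq_mk R, ← hretraction,
      AlgHom.comp_apply, hf, map_zero]
  · rintro _ ⟨s, t, h, rfl⟩
    rw [SetLike.mem_coe, RingHom.mem_ker, map_sub, monomialClassMap_multisetMonomial,
      monomialClassMap_multisetMonomial, c.eq.2 h, sub_self]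

lemma isRadical_binomialIdeal [IsReduced R] (c : AddCon (Multiset σ))
    [IsAddTorsionFree c.Quotient] : (binomialIdeal R c).IsRadical := by
  have : IsReduced (AddMonoidAlgebra R c.Quotient) := isReduced_addMonoidAlgebra
  rw [← ker_monomialClassMap]
  exact Ideal.isRadical_bot.comap _

end BinomialIdeal

section Swap

variable {ι : Type*} {V : ι → Type*}

/-- Two multisets of points have the same margins when they have the same size and, in every
direction, the same multiset of coordinates. -/
def SameMargins (s t : Multiset ((j : ι) → V j)) : Prop :=
  s.card = t.card ∧ ∀ j, s.map (· j) = t.map (· j)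

namespace SameMargins

variable {s t u : Multiset ((j : ι) → V j)} {x : (j : ι) → V j}

lemma symm (h : SameMargins s t) : SameMargins t s :=
  ⟨h.1.symm, fun j => (h.2 j).symm⟩

lemma trans (h : SameMargins s t) (h' : SameMargins t u) : SameMargins s u :=
  ⟨h.1.trans h'.1, fun j => (h.2 j).trans (h'.2 j)⟩

lemma ne_zero (h : SameMargins s t) (hs : s ≠ 0) : t ≠ 0 := by
  rwa [← Multiset.card_pos, ← h.1, Multiset.card_pos]

lemma cons (h : SameMargins s t) (x : (j : ι) → V j) : SameMargins (x ::ₘ s) (x ::ₘ t) :=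
  ⟨by simpa using h.1, fun j => by simpa using h.2 j⟩

lemma of_cons (h : SameMargins (x ::ₘ s) (x ::ₘ t)) : SameMargins s t :=
  ⟨by simpa using h.1, fun j => by simpa using h.2 j⟩

lemma of_nsmul {n : ℕ} (hn : n ≠ 0) (h : SameMargins (n • s) (n • t)) : SameMargins s t :=
  ⟨by simpa [hn] using h.1,
    fun j => nsmul_right_injective hn (by simpa only [Multiset.map_nsmul] using h.2 j)⟩

end SameMargins

lemma property_of_forall_update [DecidableEq ι] [Finite ι]
    {x y : (j : ι) → V j} {P : ((j : ι) → V j) → Prop}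
    (hP : ∀ z, P z → ∀ l, P (Function.update z l (x l))) (hy : P y) : P x := by
  cases nonempty_fintype ι
  suffices h : ∀ A : Finset ι, P (A.piecewise x y) by simpa using h Finset.univ
  intro A
  induction A using Finset.induction_on with
  | empty => simpa using hy
  | insert l A _ ih =>
    rw [Finset.piecewise_insert]
    exact hP _ ih l

variable [∀ j, Zero (V j)]

/-- A point is supported in `F` when its coordinates outside `F` vanish. -/
def SupportedIn (F : Finset ι) (x : (j : ι) → V j) : Prop :=
  ∀ j ∉ F, x j = 0

/-- An agent of `𝓕` is a point supported in every member of `𝓕`, which can therefore exchange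
coordinates with any point supported in a member of `𝓕`. -/
def IsAgent (𝓕 : Set (Finset ι)) (x : (j : ι) → V j) : Prop :=
  ∀ F ∈ 𝓕, SupportedIn F x

/-- A multiset of points is covered by `𝓕` when each of its points is supported in a member of
`𝓕`. -/
def Covered (𝓕 : Set (Finset ι)) (s : Multiset ((j : ι) → V j)) : Prop :=
  ∀ x ∈ s, ∃ F ∈ 𝓕, SupportedIn F x

variable {F G H : Finset ι} {𝓕 𝓖 : Set (Finset ι)} {s t u v r : Multiset ((j : ι) → V j)}
  {e x y z : (j : ι) → V j}

lemma SupportedIn.mono (h : F ⊆ G) (hx : SupportedIn F x) : SupportedIn G x :=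
  fun j hj => hx j (mt (@h j) hj)

lemma supportedIn_piecewise_zero [DecidableEq ι] (H : Finset ι) (x : (j : ι) → V j) :
    SupportedIn H (H.piecewise x 0) :=
  fun _ hj => Finset.piecewise_eq_of_notMem H x 0 hj

lemma isAgent_insert_iff : IsAgent (insert F 𝓕) x ↔ SupportedIn F x ∧ IsAgent 𝓕 x := by
  simp [IsAgent]

lemma isAgent_singleton_iff : IsAgent {F} x ↔ SupportedIn F x := by
  simp [IsAgent]

lemma covered_singleton_iff : Covered {F} s ↔ ∀ x ∈ s, SupportedIn F x := by
  simp [Covered]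

lemma Covered.of_le (h : s ≤ t) (ht : Covered 𝓕 t) : Covered 𝓕 s :=
  fun x hx => ht x (Multiset.mem_of_le h hx)

/-- A pivot of `s` in `F` is a point supported in `F` whose coordinates in `F` occur in `s` and are
nonzero whenever possible. Which points are pivots depends only on the margins of `s`, so two
multisets with equal margins can be reduced to a common pivot. -/
def IsPivot (F : Finset ι) (s : Multiset ((j : ι) → V j)) (x : (j : ι) → V j) : Prop :=
  SupportedIn F x ∧
    ∀ j ∈ F, x j ∈ s.map (· j) ∧ (x j = 0 → ∀ c ∈ s.map (· j), c = 0)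

lemma IsPivot.of_sameMargins (hx : IsPivot F s x) (h : SameMargins s t) : IsPivot F t x := by
  simpa only [IsPivot, h.2] using hx

lemma exists_isPivot (F : Finset ι) (hs : s ≠ 0) : ∃ x, IsPivot F s x := by
  classical
  obtain ⟨y, hy⟩ := Multiset.exists_mem_of_ne_zero hs
  have hcoord (j : ι) : ∃ c ∈ s.map (· j), c = 0 → ∀ d ∈ s.map (· j), d = 0 := by
    by_cases h : ∀ d ∈ s.map (· j), d = 0
    · exact ⟨y j, Multiset.mem_map_of_mem _ hy, fun _ => h⟩
    · push Not at h
      obtain ⟨d, hd, hd0⟩ := h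
      exact ⟨d, hd, fun h => absurd h hd0⟩
  choose c hc using hcoord
  refine ⟨F.piecewise c 0, supportedIn_piecewise_zero F c, fun j hj => ?_⟩
  simpa only [Finset.piecewise_eq_of_mem _ _ _ hj] using hc j

variable [DecidableEq ι]

/-- One swap: two points supported in a common member of `𝓕` interchange one coordinate. -/
inductive SwapStep (𝓕 : Set (Finset ι)) :
    Multiset ((j : ι) → V j) → Multiset ((j : ι) → V j) → Prop
  | swap {F : Finset ι} (hF : F ∈ 𝓕) {x y : (j : ι) → V j} (hx : SupportedIn F x)
      (hy : SupportedIn F y) (l : ι) (r : Multiset ((j : ι) → V j)) :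
      SwapStep 𝓕 (x ::ₘ y ::ₘ r)
        (Function.update x l (y l) ::ₘ Function.update y l (x l) ::ₘ r)

/-- Two multisets of points are swap equivalent when a sequence of swaps leads from one to the
other; swaps are reversible, so this is an equivalence relation. -/
def SwapRel (𝓕 : Set (Finset ι)) :
    Multiset ((j : ι) → V j) → Multiset ((j : ι) → V j) → Prop :=
  Relation.ReflTransGen (SwapStep 𝓕)

namespace SupportedIn

lemma update (hx : SupportedIn F x) (hy : SupportedIn F y) (l : ι) :
    SupportedIn F (Function.update x l (y l)) := by
  intro j hj
  obtain rfl | h := eq_or_ne j l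
  · simpa using hy j hj
  · simpa [h] using hx j hj

lemma update_of_mem (hx : SupportedIn F x) {l : ι} (hl : l ∈ F) (c : V l) :
    SupportedIn F (Function.update x l c) := by
  intro j hj
  simpa [ne_of_mem_of_not_mem hl hj |>.symm] using hx j hj

lemma piecewise_zero (hx : SupportedIn F x) (H : Finset ι) :
    SupportedIn F (H.piecewise x 0) := by
  intro j hj
  by_cases hjH : j ∈ H <;> simp [hjH, hx j hj]

end SupportedIn

namespace SwapStep

lemma symm (h : SwapStep 𝓕 s t) : SwapStep 𝓕 t s := by
  obtain @⟨F, hF, x, y, hx, hy, l, r⟩ := h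
  simpa using SwapStep.swap hF (hx.update hy l) (hy.update hx l) l r

lemma mono (h : 𝓕 ⊆ 𝓖) (hst : SwapStep 𝓕 s t) : SwapStep 𝓖 s t := by
  obtain ⟨hF, hx, hy, l, r⟩ := hst
  exact .swap (h hF) hx hy l r

lemma add_right (h : SwapStep 𝓕 s t) (u : Multiset ((j : ι) → V j)) :
    SwapStep 𝓕 (s + u) (t + u) := by
  obtain ⟨hF, hx, hy, l, r⟩ := h
  simpa using SwapStep.swap hF hx hy l (r + u)

lemma sameMargins (h : SwapStep 𝓕 s t) : SameMargins s t := by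
  obtain @⟨F, hF, x, y, hx, hy, l, r⟩ := h
  refine ⟨by simp, fun j => ?_⟩
  obtain rfl | hj := eq_or_ne j l
  · simp [Multiset.cons_swap]
  · simp [hj]

lemma covered (h : SwapStep 𝓕 s t) (hs : Covered 𝓕 s) : Covered 𝓕 t := by
  obtain @⟨F, hF, x, y, hx, hy, l, r⟩ := h
  simp only [Covered, Multiset.forall_mem_cons] at hs ⊢
  exact ⟨⟨F, hF, hx.update hy l⟩, ⟨F, hF, hy.update hx l⟩, hs.2.2⟩

end SwapStep

namespace SwapRel

lemma refl (s : Multiset ((j : ι) → V j)) : SwapRel 𝓕 s s := Relation.ReflTransGen.refl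

lemma trans (h : SwapRel 𝓕 s t) (h' : SwapRel 𝓕 t u) : SwapRel 𝓕 s u :=
  Relation.ReflTransGen.trans h h'

lemma symm (h : SwapRel 𝓕 s t) : SwapRel 𝓕 t s :=
  have : Std.Symm (SwapStep (V := V) 𝓕) := ⟨fun _ _ => SwapStep.symm⟩
  Relation.ReflTransGen.stdSymm.symm _ _ h

lemma mono (h : 𝓕 ⊆ 𝓖) (hst : SwapRel 𝓕 s t) : SwapRel 𝓖 s t :=
  Relation.ReflTransGen.mono (fun _ _ => SwapStep.mono h) _ _ hst

lemma add_right (h : SwapRel 𝓕 s t) (u : Multiset ((j : ι) → V j)) :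
    SwapRel 𝓕 (s + u) (t + u) :=
  Relation.ReflTransGen.lift (· + u) (fun _ _ h => h.add_right u) _ _ h

lemma add (h : SwapRel 𝓕 s t) (h' : SwapRel 𝓕 u v) : SwapRel 𝓕 (s + u) (t + v) := by
  refine (h.add_right u).trans ?_
  simpa only [add_comm t] using h'.add_right t

lemma cons (x : (j : ι) → V j) (h : SwapRel 𝓕 s t) : SwapRel 𝓕 (x ::ₘ s) (x ::ₘ t) := by
  simpa only [Multiset.singleton_add] using (refl {x}).add h

lemma swap (hF : F ∈ 𝓕) (hx : SupportedIn F x) (hy : SupportedIn F y) (l : ι)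
    (r : Multiset ((j : ι) → V j)) :
    SwapRel 𝓕 (x ::ₘ y ::ₘ r)
      (Function.update x l (y l) ::ₘ Function.update y l (x l) ::ₘ r) :=
  Relation.ReflTransGen.single (.swap hF hx hy l r)

lemma sameMargins (h : SwapRel 𝓕 s t) : SameMargins s t := by
  induction h with
  | refl => exact ⟨rfl, fun _ => rfl⟩
  | tail _ h ih => exact ih.trans h.sameMargins

lemma covered (h : SwapRel 𝓕 s t) (hs : Covered 𝓕 s) : Covered 𝓕 t := by
  induction h with
  | refl => exact hs
  | tail _ h ih => exact h.covered ih

lemma eq_of_empty (h : SwapRel ∅ s t) : s = t := by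
  induction h with
  | refl => rfl
  | tail _ h _ => obtain ⟨hF, _⟩ := h; exact hF.elim

end SwapRel

/-- Swap equivalence as an additive congruence. -/
def swapCon (V : ι → Type*) [∀ j, Zero (V j)] (𝓕 : Set (Finset ι)) :
    AddCon (Multiset ((j : ι) → V j)) where
  r := SwapRel 𝓕
  iseqv := ⟨.refl, .symm, .trans⟩
  add' := .add

lemma SwapRel.nsmul (h : SwapRel 𝓕 s t) (n : ℕ) : SwapRel 𝓕 (n • s) (n • t) :=
  (swapCon V 𝓕).nsmul n h

/- The new coordinates are collected one at a time, each by swapping it with its present owner. -/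
lemma SwapRel.exists_cons_of_isAgent [Finite ι] (he : IsAgent 𝓕 e) (hs : Covered 𝓕 (e ::ₘ s))
    (hx : IsAgent 𝓕 x) (hocc : ∀ j, x j ∈ (e ::ₘ s).map (· j)) :
    ∃ r, SwapRel 𝓕 (e ::ₘ s) (x ::ₘ r) := by
  suffices IsAgent 𝓕 x ∧ ∃ r, SwapRel 𝓕 (e ::ₘ s) (x ::ₘ r) from this.2
  refine property_of_forall_update (P := fun y => IsAgent 𝓕 y ∧ ∃ r, SwapRel 𝓕 (e ::ₘ s) (y ::ₘ r))
    (fun y ⟨hy, r, hr⟩ l => ⟨fun F hF => (hy F hF).update (hx F hF) l, ?_⟩) ⟨he, s, .refl _⟩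
  obtain ⟨z, hz, hzl : z l = x l⟩ := Multiset.mem_map.1 (hr.sameMargins.2 l ▸ hocc l)
  obtain rfl | hz := Multiset.mem_cons.1 hz
  · exact ⟨r, by rwa [← hzl, Function.update_eq_self]⟩
  · obtain ⟨F, hF, hzF⟩ := hr.covered hs z (Multiset.mem_cons_of_mem hz)
    obtain ⟨q, rfl⟩ := Multiset.exists_cons_of_mem hz
    exact ⟨_, hzl ▸ hr.trans (.swap hF (hy F hF) hzF l q)⟩

lemma SwapRel.exists_cons_piecewise_zero_or [Finite ι] (he : IsAgent 𝓕 e)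
    (hs : Covered 𝓕 (e ::ₘ s)) (H : Finset ι) :
    (∃ r, SwapRel 𝓕 (e ::ₘ s) (H.piecewise e 0 ::ₘ r)) ∨ ∃ j ∉ H, ∀ x ∈ e ::ₘ s, x j ≠ 0 := by
  rw [or_iff_not_imp_right]
  push Not
  refine fun h => exists_cons_of_isAgent he hs (fun F hF => (he F hF).piecewise_zero H) fun j => ?_
  by_cases hj : j ∈ H
  · rw [Finset.piecewise_eq_of_mem _ _ _ hj]
    exact Multiset.mem_map_of_mem _ (Multiset.mem_cons_self e s)
  · rw [Finset.piecewise_eq_of_notMem _ _ _ hj]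
    exact Multiset.mem_map.2 (h j hj)

/- Three swaps through the agent `e`, which holds `z l` in between. -/
lemma SwapRel.swap_of_isAgent (he : IsAgent 𝓕 e) (hF : F ∈ 𝓕) (hG : G ∈ 𝓕) (hy : SupportedIn F y)
    (hz : SupportedIn G z) {l : ι} (hlF : l ∈ F) (hlG : l ∈ G)
    (r : Multiset ((j : ι) → V j)) :
    SwapRel 𝓕 (e ::ₘ y ::ₘ z ::ₘ r)
      (e ::ₘ Function.update y l (z l) ::ₘ Function.update z l (y l) ::ₘ r) := by
  have h₁ := SwapRel.swap hG (he G hG) hz l (y ::ₘ r)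
  have h₂ := SwapRel.swap hF ((he F hF).update_of_mem hlF (z l)) hy l
    (Function.update z l (e l) ::ₘ r)
  have h₃ := SwapRel.swap hG ((he G hG).update_of_mem hlG (y l))
    (hz.update_of_mem hlG (e l)) l (Function.update y l (z l) ::ₘ r)
  simp only [Function.update_self, Function.update_idem, Function.update_eq_self] at h₁ h₂ h₃
  rw [Multiset.cons_swap z] at h₁
  rw [Multiset.cons_swap y] at h₂
  rw [Multiset.cons_swap (Function.update z l (e l)),
    Multiset.cons_swap (Function.update z l (y l))] at h₃
  exact h₁.trans (h₂.trans h₃)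

lemma SwapRel.exists_cons_cons_of_isPivot [Finite ι] (he : IsAgent 𝓕 e) (hF : F ∈ 𝓕)
    (hs : Covered 𝓕 (y ::ₘ s)) (hy : SupportedIn F y) (hx : IsPivot F (y ::ₘ s) x) :
    ∃ r, SwapRel 𝓕 (e ::ₘ y ::ₘ s) (e ::ₘ x ::ₘ r) := by
  suffices SupportedIn F x ∧ ∃ r, SwapRel 𝓕 (e ::ₘ y ::ₘ s) (e ::ₘ x ::ₘ r) from this.2
  refine property_of_forall_update (x := x)
    (P := fun y' => SupportedIn F y' ∧ ∃ r, SwapRel 𝓕 (e ::ₘ y ::ₘ s) (e ::ₘ y' ::ₘ r))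
    (fun y' ⟨hy', r, hr⟩ l => ⟨hy'.update hx.1 l, ?_⟩) ⟨hy, s, .refl _⟩
  by_cases hyl : y' l = x l
  · exact ⟨r, by rwa [← hyl, Function.update_eq_self]⟩
  have hlF : l ∈ F := by
    by_contra hlF
    exact hyl (by rw [hy' l hlF, hx.1 l hlF])
  have hmargins := hr.sameMargins.of_cons
  obtain ⟨z, hz, hzl : z l = x l⟩ := Multiset.mem_map.1 (hmargins.2 l ▸ (hx.2 l hlF).1)
  have hzr : z ∈ r := (Multiset.mem_cons.1 hz).resolve_left (by rintro rfl; exact hyl hzl)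
  have hcov : Covered 𝓕 (e ::ₘ y ::ₘ s) := Multiset.forall_mem_cons.2 ⟨⟨F, hF, he F hF⟩, hs⟩
  obtain ⟨G, hG, hzG⟩ := hr.covered hcov z (by simp [hzr])
  have hlG : l ∈ G := by
    by_contra hlG
    have hx0 : x l = 0 := hzl ▸ hzG l hlG
    have hy0 : y' l = 0 := ((hx.of_sameMargins hmargins).2 l hlF).2 hx0 _ (by simp)
    exact hyl (hy0.trans hx0.symm)
  obtain ⟨q, rfl⟩ := Multiset.exists_cons_of_mem hzr
  exact ⟨_, hzl ▸ hr.trans (.swap_of_isAgent he hF hG hy' hzG hlF hlG q)⟩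

/-- `s` can be turned by `𝓕`-swaps into a multiset that contains an agent of `𝓖`. -/
def HasAgent (𝓕 𝓖 : Set (Finset ι)) (s : Multiset ((j : ι) → V j)) : Prop :=
  ∃ x r, IsAgent 𝓖 x ∧ SwapRel 𝓕 s (x ::ₘ r)

namespace HasAgent

variable {𝓕' 𝓖' : Set (Finset ι)}

lemma of_mem (hxs : x ∈ s) (hx : IsAgent 𝓖 x) : HasAgent 𝓕 𝓖 s := by
  obtain ⟨r, rfl⟩ := Multiset.exists_cons_of_mem hxs
  exact ⟨x, r, hx, .refl _⟩

lemma of_swapRel (h : SwapRel 𝓕 s t) (ht : HasAgent 𝓕 𝓖 t) : HasAgent 𝓕 𝓖 s := by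
  obtain ⟨x, r, hx, hr⟩ := ht
  exact ⟨x, r, hx, h.trans hr⟩

lemma mono (h : 𝓕 ⊆ 𝓕') (h' : 𝓖' ⊆ 𝓖) (hs : HasAgent 𝓕 𝓖 s) : HasAgent 𝓕' 𝓖' s := by
  obtain ⟨x, r, hx, hr⟩ := hs
  exact ⟨x, r, fun F hF => hx F (h' hF), hr.mono h⟩

lemma add_right (hs : HasAgent 𝓕 𝓖 s) (t : Multiset ((j : ι) → V j)) :
    HasAgent 𝓕 𝓖 (s + t) := by
  obtain ⟨x, r, hx, hr⟩ := hs
  exact ⟨x, r + t, hx, by simpa using hr.add_right t⟩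

end HasAgent

lemma hasAgent_pair_of_sameMargins [Finite ι] (hs : Covered {F} s) (h : SameMargins s t)
    (hy : y ∈ t) (hyG : SupportedIn G y) : HasAgent {F} {F, G} s := by
  obtain ⟨z, hz⟩ := Multiset.exists_mem_of_ne_zero (h.symm.ne_zero (by rintro rfl; simp at hy))
  have hzF := covered_singleton_iff.1 hs z hz
  obtain ⟨r, rfl⟩ := Multiset.exists_cons_of_mem hz
  obtain ⟨q, hq⟩ | ⟨j, hj, hne⟩ :=
    SwapRel.exists_cons_piecewise_zero_or (isAgent_singleton_iff.2 hzF) hs G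
  · exact ⟨_, q, isAgent_insert_iff.2 ⟨hzF.piecewise_zero G,
      isAgent_singleton_iff.2 (supportedIn_piecewise_zero G z)⟩, hq⟩
  · obtain ⟨w, hw, hwj : w j = y j⟩ := Multiset.mem_map.1 (h.2 j ▸ Multiset.mem_map_of_mem _ hy)
    exact absurd (hwj.trans (hyG j hj)) (hne w hw)

lemma exists_hasAgent_singleton_of_covered_singleton [Finite ι] (hF : F ∈ 𝓕)
    (hs : Covered {F} s) (ht : Covered 𝓕 t) (h : SameMargins s t) (hs0 : s ≠ 0) :
    ∃ G ∈ 𝓕, HasAgent 𝓕 {G} s ∧ HasAgent 𝓕 {G} t := by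
  obtain ⟨y, hy⟩ := Multiset.exists_mem_of_ne_zero (h.ne_zero hs0)
  obtain ⟨G, hG, hyG⟩ := ht y hy
  exact ⟨G, hG, (hasAgent_pair_of_sameMargins hs h hy hyG).mono (by simpa using hF) (by simp),
    .of_mem hy (isAgent_singleton_iff.2 hyG)⟩

/- If no facet supports points of both multisets, the facets supporting points of one are disjoint
from those supporting points of the other, so one of the multisets involves a single facet. -/
lemma exists_hasAgent_singleton_of_sameMargins [Finite ι] (h𝓕 : 𝓕.ncard ≤ 3) (hs : Covered 𝓕 s)
    (ht : Covered 𝓕 t) (h : SameMargins s t) (hs0 : s ≠ 0) :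
    ∃ F ∈ 𝓕, HasAgent 𝓕 {F} s ∧ HasAgent 𝓕 {F} t := by
  let supporting (u : Multiset ((j : ι) → V j)) := {F ∈ 𝓕 | ∃ x ∈ u, SupportedIn F x}
  have exists_covered_singleton {u : Multiset ((j : ι) → V j)} (hu : Covered 𝓕 u) (hu0 : u ≠ 0)
      (hcard : (supporting u).ncard ≤ 1) : ∃ F ∈ 𝓕, Covered {F} u := by
    obtain ⟨x, hx⟩ := Multiset.exists_mem_of_ne_zero hu0
    obtain ⟨F, hF, hxF⟩ := hu x hx
    refine ⟨F, hF, fun z hz => ?_⟩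
    obtain ⟨G, hG, hzG⟩ := hu z hz
    exact ⟨G, (Set.ncard_le_one_iff).1 hcard ⟨hG, z, hz, hzG⟩ ⟨hF, x, hx, hxF⟩, hzG⟩
  by_cases hdisj : Disjoint (supporting s) (supporting t)
  · have hcard : (supporting s).ncard + (supporting t).ncard ≤ 3 := by
      rw [← Set.ncard_union_eq hdisj]
      exact (Set.ncard_le_ncard (Set.union_subset (Set.sep_subset ..) (Set.sep_subset ..))).trans h𝓕
    obtain hle | hle : (supporting s).ncard ≤ 1 ∨ (supporting t).ncard ≤ 1 := by omega
    · obtain ⟨F, hF, hsF⟩ := exists_covered_singleton hs hs0 hle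
      exact exists_hasAgent_singleton_of_covered_singleton hF hsF ht h hs0
    · obtain ⟨F, hF, htF⟩ := exists_covered_singleton ht (h.ne_zero hs0) hle
      simpa only [and_comm] using
        exists_hasAgent_singleton_of_covered_singleton hF htF hs h.symm (h.ne_zero hs0)
  · obtain ⟨F, ⟨hF, x, hx, hxF⟩, -, y, hy, hyF⟩ := Set.not_disjoint_iff.1 hdisj
    exact ⟨F, hF, .of_mem hx (isAgent_singleton_iff.2 hxF),
      .of_mem hy (isAgent_singleton_iff.2 hyF)⟩

/- Both multisets are reduced to a common pivot, which is then removed. -/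
lemma SwapRel.cons_of_sameMargins [Finite ι] {s t : Multiset ((j : ι) → V j)}
    (h𝓕 : 𝓕.ncard ≤ 3) (he : IsAgent 𝓕 e) (hs : Covered 𝓕 s) (ht : Covered 𝓕 t)
    (h : SameMargins s t) : SwapRel 𝓕 (e ::ₘ s) (e ::ₘ t) := by
  obtain rfl | hs0 := eq_or_ne s 0
  · obtain rfl : t = 0 := by simpa using h.1.symm
    exact .refl _
  obtain ⟨F, hF, ⟨y, r, hyF, hr⟩, y', r', hyF', hr'⟩ :=
    exists_hasAgent_singleton_of_sameMargins h𝓕 hs ht h hs0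
  obtain ⟨x, hx⟩ := exists_isPivot F (Multiset.cons_ne_zero (a := y) (m := r))
  have hx' : IsPivot F (y' ::ₘ r') x :=
    hx.of_sameMargins (hr.symm.sameMargins.trans (h.trans hr'.sameMargins))
  obtain ⟨q, hq⟩ := exists_cons_cons_of_isPivot he hF (hr.covered hs)
    (isAgent_singleton_iff.1 hyF) hx
  obtain ⟨q', hq'⟩ := exists_cons_cons_of_isPivot he hF (hr'.covered ht)
    (isAgent_singleton_iff.1 hyF') hx'
  replace hq : SwapRel 𝓕 (e ::ₘ s) (e ::ₘ x ::ₘ q) := (hr.cons e).trans hq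
  replace hq' : SwapRel 𝓕 (e ::ₘ t) (e ::ₘ x ::ₘ q') := (hr'.cons e).trans hq'
  have hcov {u p : Multiset ((j : ι) → V j)} (hu : Covered 𝓕 u)
      (hup : SwapRel 𝓕 (e ::ₘ u) (e ::ₘ x ::ₘ p)) : Covered 𝓕 p :=
    (hup.covered (Multiset.forall_mem_cons.2 ⟨⟨F, hF, he F hF⟩, hu⟩)).of_le
      ((Multiset.le_cons_self _ _).trans (Multiset.le_cons_self _ _))
  have hqq' : SwapRel 𝓕 (e ::ₘ q) (e ::ₘ q') :=
    cons_of_sameMargins h𝓕 he (hcov hs hq) (hcov ht hq')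
      (hq.sameMargins.symm.trans ((h.cons e).trans hq'.sameMargins)).of_cons.of_cons
  refine hq.trans (.trans ?_ hq'.symm)
  simpa only [Multiset.cons_swap x] using hqq'.cons x
termination_by s.card
decreasing_by simp [hq.sameMargins.of_cons.1]

lemma HasAgent.swapRel [Finite ι] (h𝓕 : 𝓕.ncard ≤ 3) (hs : Covered 𝓕 s) (ht : Covered 𝓕 t)
    (hsa : HasAgent 𝓕 𝓕 s) (hta : HasAgent 𝓕 𝓕 t) (h : SameMargins s t) : SwapRel 𝓕 s t := by
  obtain ⟨e, r, he, hr⟩ := hsa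
  obtain ⟨f, q, hf, hq⟩ := hta
  have her : SameMargins (e ::ₘ r) (f ::ₘ q) := hr.symm.sameMargins.trans (h.trans hq.sameMargins)
  obtain ⟨p, hp⟩ := SwapRel.exists_cons_of_isAgent he (hr.covered hs) hf fun j => by
    rw [her.2 j]
    exact Multiset.mem_map_of_mem _ (Multiset.mem_cons_self f q)
  have hpq := (hp.symm.sameMargins.trans her).of_cons
  have hcov {u w : Multiset ((j : ι) → V j)} (hu : Covered 𝓕 u) (huw : SwapRel 𝓕 u (f ::ₘ w)) :
      Covered 𝓕 w := (huw.covered hu).of_le (Multiset.le_cons_self _ _)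
  exact (hr.trans hp).trans
    (.trans (.cons_of_sameMargins h𝓕 hf (hcov hs (hr.trans hp)) (hcov ht hq) hpq) hq.symm)

/-- The swap class of `u` is determined by the class of any of its positive multiples. -/
def SwapTorsionFreeAt (𝓕 : Set (Finset ι)) (u : Multiset ((j : ι) → V j)) : Prop :=
  ∀ n : ℕ, n ≠ 0 → ∀ s, SwapRel 𝓕 (n • u) (n • s) → SwapRel 𝓕 u s

/-- No multiset swap equivalent to a multiple of `u` has an element supported in `F`: the points of
`u` never take part in a swap inside `F`. -/
def SwapAvoids (𝓕 : Set (Finset ι)) (u : Multiset ((j : ι) → V j)) (F : Finset ι) : Prop :=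
  ∀ (n : ℕ) w, SwapRel 𝓕 (n • u) w → ∀ x ∈ w, ¬ SupportedIn F x

lemma SwapTorsionFreeAt.of_swapRel (h : SwapRel 𝓕 s t) (ht : SwapTorsionFreeAt 𝓕 t) :
    SwapTorsionFreeAt 𝓕 s :=
  fun n hn w hw => h.trans (ht n hn w ((h.symm.nsmul n).trans hw))

lemma SwapAvoids.of_swapRel (h : SwapRel 𝓕 s t) (ht : SwapAvoids 𝓕 t F) : SwapAvoids 𝓕 s F :=
  fun n w hw => ht n w ((h.symm.nsmul n).trans hw)

lemma swapAvoids_of_forall_ne_zero {j : ι} (hj : j ∉ F) (hu : ∀ x ∈ u, x j ≠ 0) :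
    SwapAvoids 𝓕 u F := by
  intro n w hw x hx hxF
  obtain ⟨z, hz, hzj : z j = x j⟩ :=
    Multiset.mem_map.1 (hw.sameMargins.2 j ▸ Multiset.mem_map_of_mem _ hx)
  exact hu z (Multiset.mem_of_mem_nsmul hz) (hzj.trans (hxF j hj))

lemma swapAvoids_zero (𝓕 : Set (Finset ι)) (F : Finset ι) :
    SwapAvoids (V := V) 𝓕 0 F := by
  intro n w hw
  obtain rfl : w = 0 := by simpa using hw.sameMargins.1.symm
  simp

lemma swapTorsionFreeAt_zero (𝓕 : Set (Finset ι)) : SwapTorsionFreeAt (V := V) 𝓕 0 := by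
  intro n hn s h
  obtain rfl : s = 0 := by simpa using (h.sameMargins.of_nsmul hn).1.symm
  exact .refl _

lemma swapTorsionFreeAt_empty (u : Multiset ((j : ι) → V j)) : SwapTorsionFreeAt ∅ u := by
  intro n hn s h
  obtain rfl : u = s := nsmul_right_injective hn h.eq_of_empty
  exact .refl _

lemma hasAgent_insert_or_swapAvoids [Finite ι] (hs : Covered 𝓕 s) (ha : HasAgent 𝓕 𝓕 s)
    (H : Finset ι) : HasAgent 𝓕 (insert H 𝓕) s ∨ SwapAvoids 𝓕 s H := by
  obtain ⟨e, r, he, hr⟩ := ha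
  obtain ⟨q, hq⟩ | ⟨j, hj, hne⟩ := SwapRel.exists_cons_piecewise_zero_or he (hr.covered hs) H
  · exact .inl ⟨_, q, isAgent_insert_iff.2 ⟨supportedIn_piecewise_zero H e,
      fun F hF => (he F hF).piecewise_zero H⟩, hr.trans hq⟩
  · exact .inr (.of_swapRel hr (swapAvoids_of_forall_ne_zero hj hne))

lemma eq_zero_or_hasAgent_singleton (hs : Covered {F} s) : s = 0 ∨ HasAgent {F} {F} s := by
  obtain rfl | ⟨z, hz⟩ := Multiset.empty_or_exists_mem s
  · exact .inl rfl
  · exact .inr (.of_mem hz (isAgent_singleton_iff.2 (covered_singleton_iff.1 hs z hz)))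

lemma hasAgent_pair_or_swapAvoids [Finite ι] (hs : Covered {F} s) (G : Finset ι) :
    HasAgent {F} {F, G} s ∨ SwapAvoids {F} s G := by
  obtain rfl | ha := eq_zero_or_hasAgent_singleton hs
  · exact .inr (swapAvoids_zero _ G)
  · rw [Set.pair_comm]
    exact hasAgent_insert_or_swapAvoids hs ha G

lemma SwapStep.exists_add_left (h : SwapStep 𝓕 (u + v) w)
    (hv : ∀ F ∈ 𝓕, ∀ x ∈ v, ¬ SupportedIn F x) : ∃ u', w = u' + v ∧ SwapStep 𝓕 u u' := by
  generalize huv : u + v = s at h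
  obtain @⟨F, hF, x, y, hx, hy, l, r⟩ := h
  have mem_left {p : Multiset ((j : ι) → V j)} {z : (j : ι) → V j} (hz : SupportedIn F z)
      (hzp : z ∈ p + v) : z ∈ p :=
    (Multiset.mem_add.1 hzp).resolve_right fun hzv => hv F hF z hzv hz
  obtain ⟨u, rfl⟩ := Multiset.exists_cons_of_mem (mem_left hx (p := u) (by simp [huv]))
  rw [Multiset.cons_add, Multiset.cons_inj_right] at huv
  obtain ⟨u, rfl⟩ := Multiset.exists_cons_of_mem (mem_left hy (p := u) (by simp [huv]))
  rw [Multiset.cons_add, Multiset.cons_inj_right] at huv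
  subst huv
  exact ⟨_, by simp only [Multiset.cons_add], .swap hF hx hy l u⟩

lemma SwapRel.exists_add {n : ℕ} (hu : ∀ G ∈ 𝓖, SwapAvoids 𝓕 u G)
    (hv : ∀ F ∈ 𝓕, SwapAvoids 𝓖 v F) (h : SwapRel (𝓕 ∪ 𝓖) (n • (u + v)) w) :
    ∃ u' v', w = u' + v' ∧ SwapRel 𝓕 (n • u) u' ∧ SwapRel 𝓖 (n • v) v' := by
  induction h with
  | refl => exact ⟨n • u, n • v, nsmul_add u v n, .refl _, .refl _⟩
  | tail _ h ih =>
    obtain ⟨u', v', rfl, hu', hv'⟩ := ih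
    generalize huv : u' + v' = s at h
    obtain ⟨hF | hG, hx, hy, l, r⟩ := h
    · obtain ⟨u'', hw, hstep⟩ := (huv ▸ SwapStep.swap hF hx hy l r).exists_add_left
        fun F hF => hv F hF n v' hv'
      exact ⟨u'', v', hw, hu'.tail hstep, hv'⟩
    · obtain ⟨v'', hw, hstep⟩ := (add_comm u' v' ▸ huv ▸ SwapStep.swap hG hx hy l r).exists_add_left
        fun G hG => hu G hG n u' hu'
      exact ⟨u', v'', hw.trans (add_comm _ _), hu', hv'.tail hstep⟩

lemma SwapAvoids.add (huv : ∀ G ∈ 𝓖, SwapAvoids 𝓕 u G) (hvu : ∀ F ∈ 𝓕, SwapAvoids 𝓖 v F)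
    (hu : SwapAvoids 𝓕 u H) (hv : SwapAvoids 𝓖 v H) : SwapAvoids (𝓕 ∪ 𝓖) (u + v) H := by
  intro n w hw x hx
  obtain ⟨u', v', rfl, hu', hv'⟩ := hw.exists_add huv hvu
  exact (Multiset.mem_add.1 hx).elim (hu n u' hu' x) (hv n v' hv' x)

lemma SwapTorsionFreeAt.add (hus : Covered 𝓕 u) (huv : ∀ G ∈ 𝓖, SwapAvoids 𝓕 u G)
    (hvu : ∀ F ∈ 𝓕, SwapAvoids 𝓖 v F) (hu : SwapTorsionFreeAt 𝓕 u)
    (hv : SwapTorsionFreeAt 𝓖 v) : SwapTorsionFreeAt (𝓕 ∪ 𝓖) (u + v) := by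
  classical
  intro n hn s h
  obtain ⟨u', v', hs, hu', hv'⟩ := h.exists_add huv hvu
  let inF (x : (j : ι) → V j) : Prop := ∃ F ∈ 𝓕, SupportedIn F x
  have hu'F : ∀ x ∈ u', inF x :=
    hu'.covered fun x hx => hus x (Multiset.mem_of_mem_nsmul hx)
  have hv'F : ∀ x ∈ v', ¬ inF x := fun x hx ⟨F, hF, hxF⟩ => hvu F hF n v' hv' x hx hxF
  obtain rfl : u' = n • s.filter inF := by
    rw [← Multiset.filter_nsmul, hs, Multiset.filter_add, Multiset.filter_eq_self.2 hu'F,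
      Multiset.filter_eq_nil.2 hv'F, add_zero]
  obtain rfl : v' = n • s.filter (¬ inF ·) := by
    rw [← Multiset.filter_nsmul, hs, Multiset.filter_add, Multiset.filter_eq_self.2 hv'F,
      Multiset.filter_eq_nil.2 fun x hx => not_not.2 (hu'F x hx), zero_add]
  rw [← Multiset.filter_add_not inF s]
  exact ((hu n hn _ hu').mono Set.subset_union_left).add
    ((hv n hn _ hv').mono Set.subset_union_right)

/- The points of `s` that are supported in no member of `𝓕` are inert. Two covered multisets with
agents and with equal multiples have the same margins, so they are equivalent. -/
lemma swapTorsionFreeAt_of_hasAgent_or [Finite ι] (h𝓕 : 𝓕.ncard ≤ 3)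
    (h : ∀ s : Multiset ((j : ι) → V j), Covered 𝓕 s →
      HasAgent 𝓕 𝓕 s ∨ SwapTorsionFreeAt 𝓕 s)
    (s : Multiset ((j : ι) → V j)) : SwapTorsionFreeAt 𝓕 s := by
  classical
  have of_covered {s : Multiset ((j : ι) → V j)} (hs : Covered 𝓕 s) : SwapTorsionFreeAt 𝓕 s := by
    refine (h s hs).elim (fun hsa n hn t hst => ?_) id
    have ht : Covered 𝓕 t := fun x hx =>
      hst.covered (fun x hx => hs x (Multiset.mem_of_mem_nsmul hx)) x
        ((Multiset.mem_nsmul_of_ne_zero hn).2 hx)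
    obtain hta | htf := h t ht
    · exact hsa.swapRel h𝓕 hs ht hta (hst.sameMargins.of_nsmul hn)
    · exact (htf n hn s hst.symm).symm
  let inF (x : (j : ι) → V j) : Prop := ∃ F ∈ 𝓕, SupportedIn F x
  have hcov : Covered 𝓕 (s.filter inF) := fun x hx => (Multiset.mem_filter.1 hx).2
  rw [← Multiset.filter_add_not inF s, ← Set.union_empty 𝓕]
  refine .add hcov (by simp) (fun F hF n w hw x hx hxF => ?_) (of_covered hcov)
    (swapTorsionFreeAt_empty _)
  rw [← hw.eq_of_empty] at hx
  exact (Multiset.mem_filter.1 (Multiset.mem_of_mem_nsmul hx)).2 ⟨F, hF, hxF⟩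

lemma swapTorsionFreeAt_singleton [Finite ι] (F : Finset ι) (s : Multiset ((j : ι) → V j)) :
    SwapTorsionFreeAt {F} s := by
  refine swapTorsionFreeAt_of_hasAgent_or (by simp) (fun s hs => ?_) s
  obtain rfl | ha := eq_zero_or_hasAgent_singleton hs
  · exact .inr (swapTorsionFreeAt_zero _)
  · exact .inl ha

/- Without agents shared by two facets, the parts of `s` in the various facets never interact. -/
lemma swapTorsionFreeAt_and_swapAvoids_of_not_hasAgent_pair [Finite ι] {𝓤 : Set (Finset ι)}
    (h𝓕 : 𝓕 ⊆ 𝓤) (hs : Covered 𝓕 s)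
    (hna : ∀ F ∈ 𝓕, ∀ G ∈ 𝓤, F ≠ G → ¬ HasAgent 𝓕 {F, G} s) :
    SwapTorsionFreeAt 𝓕 s ∧ ∀ G ∈ 𝓤 \ 𝓕, SwapAvoids 𝓕 s G := by
  classical
  induction 𝓕, Set.toFinite 𝓕 using Set.Finite.induction_on generalizing s with
  | empty =>
    obtain rfl : s = 0 := Multiset.eq_zero_of_forall_notMem fun x hx => by simpa using hs x hx
    exact ⟨swapTorsionFreeAt_empty _, fun G _ => swapAvoids_zero _ G⟩
  | @insert F 𝓖 hF𝓖 _ ih =>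
    obtain ⟨hF, h𝓖⟩ := Set.insert_subset_iff.1 h𝓕
    rw [← Multiset.filter_add_not (SupportedIn F) s] at hna ⊢
    set u := s.filter (SupportedIn F)
    set v := s.filter (¬ SupportedIn F ·)
    have hu : Covered {F} u := covered_singleton_iff.2 fun x hx => (Multiset.mem_filter.1 hx).2
    have hv : Covered 𝓖 v := fun x hx => by
      obtain ⟨hxs, hxF⟩ := Multiset.mem_filter.1 hx
      obtain ⟨G, rfl | hG, hxG⟩ := hs x hxs
      exacts [absurd hxG hxF, ⟨G, hG, hxG⟩]
    have hu_avoids (G) (hG : G ∈ 𝓤) (hFG : F ≠ G) : SwapAvoids {F} u G :=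
      (hasAgent_pair_or_swapAvoids hu G).resolve_left fun ha =>
        hna F (by simp) G hG hFG ((ha.mono (by simp) subset_rfl).add_right v)
    obtain ⟨hv_tf, hv_avoids⟩ := ih h𝓖 hv fun F' hF' G hG hne ha =>
      hna F' (.inr hF') G hG hne (add_comm v u ▸
        (ha.mono (Set.subset_insert F 𝓖) subset_rfl).add_right u)
    have huv : ∀ G ∈ 𝓖, SwapAvoids {F} u G := fun G hG =>
      hu_avoids G (h𝓖 hG) (ne_of_mem_of_not_mem hG hF𝓖).symm
    have hvu : ∀ F' ∈ ({F} : Set (Finset ι)), SwapAvoids 𝓖 v F' := by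
      simpa using hv_avoids F ⟨hF, hF𝓖⟩
    rw [Set.insert_eq]
    refine ⟨.add hu huv hvu (swapTorsionFreeAt_singleton F u) hv_tf, fun G ⟨hG, hG𝓕⟩ => ?_⟩
    simp only [Set.singleton_union, Set.mem_insert_iff, not_or] at hG𝓕
    exact .add huv hvu (hu_avoids G hG (Ne.symm hG𝓕.1)) (hv_avoids G ⟨hG, hG𝓕.2⟩)

lemma hasAgent_insert_of_hasAgent_pair [Finite ι] (he : IsAgent 𝓖 e) (hG : G ∈ 𝓖)
    (hs : HasAgent {H} {H, G} s) : HasAgent (insert H 𝓖) (insert H 𝓖) (e ::ₘ s) := by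
  obtain ⟨f, r, hf, hr⟩ := hs
  obtain ⟨hfH, hfG⟩ := isAgent_insert_iff.1 hf
  have hpair : Covered {G} (e ::ₘ {f}) := by
    simpa [covered_singleton_iff] using ⟨he G hG, isAgent_singleton_iff.1 hfG⟩
  obtain ⟨q, hq⟩ | ⟨j, hj, hne⟩ := SwapRel.exists_cons_piecewise_zero_or
    (isAgent_singleton_iff.2 (he G hG)) hpair H
  · refine ⟨H.piecewise e 0, q + r, isAgent_insert_iff.2 ⟨supportedIn_piecewise_zero H e,
      fun F hF => (he F hF).piecewise_zero H⟩, ((hr.mono (by simp)).cons e).trans ?_⟩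
    simpa using (hq.mono (Set.singleton_subset_iff.2 (.inr hG))).add_right r
  · exact absurd (hfH j hj) (hne f (by simp))

lemma hasAgent_or_swapTorsionFreeAt_insert [Finite ι] (h𝓖 : 𝓖.Nonempty)
    (htf : ∀ s : Multiset ((j : ι) → V j), SwapTorsionFreeAt 𝓖 s)
    (hs : Covered (insert H 𝓖) s) (ha : HasAgent (insert H 𝓖) 𝓖 s) :
    HasAgent (insert H 𝓖) (insert H 𝓖) s ∨ SwapTorsionFreeAt (insert H 𝓖) s := by
  classical
  obtain ⟨e, r, he, hr⟩ := ha
  refine Or.imp (.of_swapRel hr) (.of_swapRel hr) (or_iff_not_imp_left.2 fun hna => ?_)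
  let inG (x : (j : ι) → V j) : Prop := ∃ G ∈ 𝓖, SupportedIn G x
  have heG : inG e := h𝓖.imp fun G hG => ⟨hG, he G hG⟩
  rw [← Multiset.filter_add_not inG r, ← Multiset.cons_add] at hna ⊢
  set u := r.filter inG
  set v := r.filter (¬ inG ·)
  have hu : Covered 𝓖 (e ::ₘ u) :=
    Multiset.forall_mem_cons.2 ⟨heG, fun x hx => (Multiset.mem_filter.1 hx).2⟩
  have hv : Covered {H} v := covered_singleton_iff.2 fun x hx => by
    obtain ⟨hxr, hxG⟩ := Multiset.mem_filter.1 hx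
    obtain ⟨F, rfl | hF, hxF⟩ := hr.covered hs x (Multiset.mem_cons_of_mem hxr)
    exacts [hxF, absurd ⟨F, hF, hxF⟩ hxG]
  have hu_avoids : SwapAvoids 𝓖 (e ::ₘ u) H :=
    (hasAgent_insert_or_swapAvoids hu (.of_mem (by simp) he) H).resolve_left fun ha =>
      hna ((ha.mono (Set.subset_insert H 𝓖) subset_rfl).add_right v)
  have hv_avoids (G) (hG : G ∈ 𝓖) : SwapAvoids {H} v G :=
    (hasAgent_pair_or_swapAvoids hv G).resolve_left fun ha => by
      refine hna ?_
      rw [Multiset.cons_add, add_comm u v, ← Multiset.cons_add]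
      exact (hasAgent_insert_of_hasAgent_pair he hG ha).add_right u
  rw [← Set.union_singleton]
  exact .add hu (by simpa using hu_avoids) hv_avoids (htf _) (swapTorsionFreeAt_singleton H v)

lemma swapTorsionFreeAt_pair [Finite ι] (F G : Finset ι) (s : Multiset ((j : ι) → V j)) :
    SwapTorsionFreeAt {F, G} s := by
  have hcard : ({F, G} : Set (Finset ι)).ncard ≤ 3 := (Set.ncard_insert_le F {G}).trans (by simp)
  refine swapTorsionFreeAt_of_hasAgent_or hcard (fun s hs => or_iff_not_imp_left.2 fun hna => ?_) s
  refine (swapTorsionFreeAt_and_swapAvoids_of_not_hasAgent_pair subset_rfl hs ?_).1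
  rintro F' (rfl | rfl) G' (rfl | rfl) hne
  exacts [(hne rfl).elim, hna, Set.pair_comm F' G' ▸ hna, (hne rfl).elim]

lemma eq_pair_or_eq_insert_pair_of_ncard_le_three {α : Type*} {S : Set α} [Finite S]
    (hS : S.ncard ≤ 3) {a b : α} (ha : a ∈ S) (hb : b ∈ S) (hab : a ≠ b) :
    S = {a, b} ∨ ∃ c, S = {c, a, b} := by
  have hpair : {a, b} ⊆ S := Set.insert_subset ha (Set.singleton_subset_iff.2 hb)
  have hle : (S \ {a, b}).ncard ≤ 1 := by
    have := Set.ncard_sdiff_add_ncard_of_subset hpair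
    rw [Set.ncard_pair hab] at this
    omega
  rw [← Set.sdiff_union_of_subset hpair]
  obtain h | ⟨c, h⟩ := (Set.ncard_le_one_iff_eq).1 hle
  · exact .inl (by rw [h, Set.empty_union])
  · exact .inr ⟨c, by rw [h, Set.singleton_union]⟩

theorem swapTorsionFreeAt_of_ncard_le_three [Finite ι] (h𝓕 : 𝓕.ncard ≤ 3)
    (s : Multiset ((j : ι) → V j)) : SwapTorsionFreeAt 𝓕 s := by
  refine swapTorsionFreeAt_of_hasAgent_or h𝓕 (fun s hs => ?_) s
  by_cases hna : ∀ F ∈ 𝓕, ∀ G ∈ 𝓕, F ≠ G → ¬ HasAgent 𝓕 {F, G} s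
  · exact .inr (swapTorsionFreeAt_and_swapAvoids_of_not_hasAgent_pair subset_rfl hs hna).1
  push Not at hna
  obtain ⟨F, hF, G, hG, hFG, ha⟩ := hna
  obtain rfl | ⟨H, rfl⟩ := eq_pair_or_eq_insert_pair_of_ncard_le_three h𝓕 hF hG hFG
  · exact .inl ha
  · exact hasAgent_or_swapTorsionFreeAt_insert (Set.insert_nonempty F {G})
      (swapTorsionFreeAt_pair F G) hs ha

open MvPolynomial

/-- The ideal generated by the quadratic binomials of the swaps in `F`. -/
noncomputable def swapIdeal (R : Type*) [CommRing R] (V : ι → Type*) [∀ j, Zero (V j)]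
    (F : Finset ι) : Ideal (MvPolynomial ((j : ι) → V j) R) :=
  Ideal.span {f | ∃ x y : (j : ι) → V j, SupportedIn F x ∧ SupportedIn F y ∧ ∃ l,
    f = X x * X y - X (Function.update x l (y l)) * X (Function.update y l (x l))}

variable {R : Type*} [CommRing R]

lemma swapIdeal_mono (h : F ⊆ G) : swapIdeal R V F ≤ swapIdeal R V G :=
  Ideal.span_mono fun _ ⟨x, y, hx, hy, l, hf⟩ => ⟨x, y, hx.mono h, hy.mono h, l, hf⟩

lemma iSup_swapIdeal (𝓕 : Set (Finset ι)) :
    ⨆ F ∈ 𝓕, swapIdeal R V F = binomialIdeal R (swapCon V 𝓕) := by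
  have multisetMonomial_pair (x y : (j : ι) → V j) :
      multisetMonomial R (x ::ₘ y ::ₘ 0) = X x * X y := by
    simp [multisetMonomial]
  refine le_antisymm (iSup₂_le fun F hF => Ideal.span_le.2 ?_) (Ideal.span_le.2 ?_)
  · rintro _ ⟨x, y, hx, hy, l, rfl⟩
    simp only [← multisetMonomial_pair]
    exact Ideal.subset_span ⟨_, _, SwapRel.swap hF hx hy l 0, rfl⟩
  · rintro _ ⟨s, t, h, rfl⟩
    replace h : SwapRel 𝓕 s t := h
    induction h with
    | refl => simp
    | tail _ h ih =>
      rw [← sub_add_sub_cancel]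
      refine add_mem ih ?_
      obtain @⟨F, hF, x, y, hx, hy, l, r⟩ := h
      have hmem : X x * X y - X (Function.update x l (y l)) * X (Function.update y l (x l)) ∈
          ⨆ F ∈ 𝓕, swapIdeal R V F :=
        le_iSup₂ (f := fun F (_ : F ∈ 𝓕) => swapIdeal R V F) F hF
          (Ideal.subset_span ⟨x, y, hx, hy, l, rfl⟩)
      convert Ideal.mul_mem_right (multisetMonomial R r) _ hmem using 1
      simp only [multisetMonomial, Multiset.map_cons, Multiset.prod_cons]
      ring

lemma isAddTorsionFree_quotient_swapCon [Finite ι] (h𝓕 : 𝓕.ncard ≤ 3) :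
    IsAddTorsionFree (swapCon V 𝓕).Quotient where
  nsmul_right_injective n hn := by
    rintro ⟨s⟩ ⟨t⟩ h
    exact (swapCon V 𝓕).eq.2
      (swapTorsionFreeAt_of_ncard_le_three h𝓕 s n hn t ((swapCon V 𝓕).eq.1 h))

theorem isRadical_iSup_swapIdeal [Finite ι] [IsReduced R] (h𝓕 : 𝓕.ncard ≤ 3) :
    (⨆ F ∈ 𝓕, swapIdeal R V F).IsRadical := by
  have := isAddTorsionFree_quotient_swapCon (V := V) h𝓕
  rw [iSup_swapIdeal]
  exact isRadical_binomialIdeal _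

lemma iSup_swapIdeal_maximal [Finite ι] (𝓕 : Set (Finset ι)) :
    ⨆ F ∈ {F | Maximal (· ∈ 𝓕) F}, swapIdeal R V F = ⨆ F ∈ 𝓕, swapIdeal R V F := by
  refine le_antisymm (biSup_mono fun F hF => hF.prop) (iSup₂_le fun F hF => ?_)
  obtain ⟨G, hFG, hG⟩ := (Set.toFinite 𝓕).exists_le_maximal hF
  exact (swapIdeal_mono hFG).trans (le_iSup₂_of_le G hG le_rfl)

end Swap

lemma segreIdeal_map {ι : Type*} [DecidableEq ι] {b : ι → ℕ} {R S F : Type*} [CommRing R]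
    [CommRing S] [FunLike F R S] [RingHomClass F R S] (φ : F) (B : ((j : ι) → Fin (b j)) → R) :
    (segreIdeal B).map φ = segreIdeal fun i => φ (B i) := by
  have map_tableMinor (l : ι) (i k : (j : ι) → Fin (b j)) :
      φ (tableMinor B l i k) = tableMinor (fun i => φ (B i)) l i k := by
    simp only [tableMinor, Matrix.det_fin_two_of, map_sub, map_mul]
  rw [segreIdeal, segreIdeal, Ideal.map_span]
  congr 1
  ext f
  constructor
  · rintro ⟨_, ⟨l, i, k, rfl⟩, rfl⟩
    exact ⟨l, i, k, map_tableMinor l i k⟩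
  · rintro ⟨l, i, k, rfl⟩
    exact ⟨_, ⟨l, i, k, rfl⟩, map_tableMinor l i k⟩

section TableAct

variable {ι : Type*} [Fintype ι] [DecidableEq ι] {a b c : ι → ℕ} {R S : Type*} [CommRing R]
  [CommRing S]

/-- The table obtained from `B` by acting with the matrix `U j` on the `j`-th coordinate. -/
def tableAct (U : (j : ι) → Matrix (Fin (a j)) (Fin (b j)) ℤ) (B : ((j : ι) → Fin (b j)) → R) :
    ((j : ι) → Fin (a j)) → R :=
  fun i => ∑ k, (∏ j, U j (i j) (k j)) • B k

lemma map_tableAct {F : Type*} [FunLike F R S] [RingHomClass F R S] (φ : F)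
    (U : (j : ι) → Matrix (Fin (a j)) (Fin (b j)) ℤ) (B : ((j : ι) → Fin (b j)) → R)
    (i : (j : ι) → Fin (a j)) : φ (tableAct U B i) = tableAct U (fun k => φ (B k)) i := by
  simp only [tableAct, map_sum, map_zsmul]

lemma tableAct_tableAct (U : (j : ι) → Matrix (Fin (a j)) (Fin (b j)) ℤ)
    (W : (j : ι) → Matrix (Fin (b j)) (Fin (c j)) ℤ) (B : ((j : ι) → Fin (c j)) → R) :
    tableAct U (tableAct W B) = tableAct (fun j => U j * W j) B := by
  funext i
  simp only [tableAct, Finset.smul_sum, smul_smul, Matrix.mul_apply]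
  rw [Finset.sum_comm]
  refine Finset.sum_congr rfl fun m _ => ?_
  rw [← Finset.sum_smul, Finset.prod_univ_sum, Fintype.piFinset_univ]
  simp only [Finset.prod_mul_distrib]

lemma tableAct_one (B : ((j : ι) → Fin (b j)) → R) :
    tableAct (fun _ => 1) B = B := by
  funext i
  rw [tableAct, Finset.sum_eq_single i]
  · simp
  · intro k _ hk
    obtain ⟨j, hj⟩ := Function.ne_iff.1 hk
    rw [Finset.prod_eq_zero (Finset.mem_univ j), zero_smul]
    exact Matrix.one_apply_ne hj.symm
  · simp

lemma tableMinor_tableAct (U : (j : ι) → Matrix (Fin (a j)) (Fin (b j)) ℤ)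
    (B : ((j : ι) → Fin (b j)) → R) (l : ι) (i k : (j : ι) → Fin (a j)) :
    tableMinor (tableAct U B) l i k =
      ∑ z : ((j : ι) → Fin (b j)) × ((j : ι) → Fin (b j)),
        ((∏ j, U j (i j) (z.1 j)) * ∏ j, U j (k j) (z.2 j)) • tableMinor B l z.1 z.2 := by
  let coeff (x y : (j : ι) → Fin (a j)) (z : ((j : ι) → Fin (b j)) × ((j : ι) → Fin (b j))) : ℤ :=
    (∏ j, U j (x j) (z.1 j)) * ∏ j, U j (y j) (z.2 j)
  have mul_eq_sum (x y : (j : ι) → Fin (a j)) :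
      tableAct U B x * tableAct U B y = ∑ z, coeff x y z • (B z.1 * B z.2) := by
    simp only [tableAct, coeff, Finset.sum_mul_sum, Fintype.sum_prod_type, smul_mul_smul_comm]
  let swap (z : ((j : ι) → Fin (b j)) × ((j : ι) → Fin (b j))) :=
    (Function.update z.2 l (z.1 l), Function.update z.1 l (z.2 l))
  have swap_involutive : Function.Involutive swap := fun z => by simp [swap]
  have coeff_swap (z) : coeff (Function.update k l (i l)) (Function.update i l (k l)) (swap z) =
      coeff i k z := by
    simp only [coeff, ← Finset.prod_mul_distrib]
    refine Finset.prod_congr rfl fun j _ => ?_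
    obtain rfl | hj := eq_or_ne j l
    · simp [swap]
    · simp [swap, hj, mul_comm]
  have hswap : tableAct U B (Function.update k l (i l)) * tableAct U B (Function.update i l (k l)) =
      ∑ z, coeff i k z • (B (swap z).1 * B (swap z).2) := by
    rw [mul_eq_sum, ← Equiv.sum_comp swap_involutive.toPerm]
    simp only [Function.Involutive.coe_toPerm, coeff_swap]
  simp only [tableMinor, Matrix.det_fin_two_of, hswap, mul_eq_sum, ← Finset.sum_sub_distrib,
    ← smul_sub, coeff, swap]

lemma segreIdeal_tableAct_le (U : (j : ι) → Matrix (Fin (a j)) (Fin (b j)) ℤ)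
    (B : ((j : ι) → Fin (b j)) → R) : segreIdeal (tableAct U B) ≤ segreIdeal B := by
  refine Ideal.span_le.2 ?_
  rintro _ ⟨l, i, k, rfl⟩
  rw [tableMinor_tableAct]
  refine sum_mem fun z _ => ?_
  have hz : tableMinor B l z.1 z.2 ∈ segreIdeal B := Ideal.subset_span ⟨l, z.1, z.2, rfl⟩
  exact zsmul_mem hz _

variable {U W : (j : ι) → Matrix (Fin (b j)) (Fin (b j)) ℤ}

lemma segreIdeal_tableAct (hWU : ∀ j, W j * U j = 1) (B : ((j : ι) → Fin (b j)) → R) :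
    segreIdeal (tableAct U B) = segreIdeal B := by
  refine le_antisymm (segreIdeal_tableAct_le U B) ?_
  simpa only [tableAct_tableAct, hWU, tableAct_one] using segreIdeal_tableAct_le W (tableAct U B)

lemma aeval_tableAct_comp_aeval_tableAct (hUW : ∀ j, U j * W j = 1) :
    (MvPolynomial.aeval (tableAct W (MvPolynomial.X (R := R)))).comp
      (MvPolynomial.aeval (tableAct U MvPolynomial.X)) = AlgHom.id R _ := by
  ext1 i
  rw [AlgHom.comp_apply, MvPolynomial.aeval_X, map_tableAct]
  simp only [MvPolynomial.aeval_X]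
  change tableAct U (tableAct W MvPolynomial.X) i = MvPolynomial.X i
  simp only [tableAct_tableAct, hUW, tableAct_one]

/-- The linear change of coordinates `X ↦ tableAct U X` of the polynomial ring in the entries of
the generic table, for invertible matrices `U j`. -/
noncomputable def tableActEquiv (R : Type*) [CommRing R] (hUW : ∀ j, U j * W j = 1) :
    MvPolynomial ((j : ι) → Fin (b j)) R ≃+* MvPolynomial ((j : ι) → Fin (b j)) R :=
  (AlgEquiv.ofAlgHom (MvPolynomial.aeval (tableAct U MvPolynomial.X))
    (MvPolynomial.aeval (tableAct W MvPolynomial.X))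
    (aeval_tableAct_comp_aeval_tableAct fun j => mul_eq_one_comm.1 (hUW j))
    (aeval_tableAct_comp_aeval_tableAct hUW)).toRingEquiv

lemma tableActEquiv_X (hUW : ∀ j, U j * W j = 1) (i : (j : ι) → Fin (b j)) :
    tableActEquiv R hUW (MvPolynomial.X i) = tableAct U MvPolynomial.X i :=
  MvPolynomial.aeval_X _ i

end TableAct

section Margins

open MvPolynomial

/-- The matrix that replaces the entry at `0` of a vector by the sum of all entries. -/
def marginMatrix (m : ℕ) [NeZero m] : Matrix (Fin m) (Fin m) ℤ :=
  Matrix.updateRow 1 0 1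

lemma det_marginMatrix (m : ℕ) [NeZero m] : (marginMatrix m).det = 1 := by
  have sum_rows : ∑ k, (1 : Fin m → ℤ) k • (1 : Matrix (Fin m) (Fin m) ℤ) k = 1 := by
    ext i
    rw [Finset.sum_apply]
    simp [Matrix.one_apply]
  rw [marginMatrix, ← sum_rows, Matrix.det_updateRow_sum, Matrix.det_one, Pi.one_apply, one_smul]

/-- The index that agrees with `s` in `J` and vanishes outside `J`. -/
def extendIndex {ι : Type*} [DecidableEq ι] {a : ι → ℕ} [∀ j, NeZero (a j)] (J : Finset ι)
    (s : (j : J) → Fin (a j)) : (j : ι) → Fin (a j) :=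
  fun j => if h : j ∈ J then s ⟨j, h⟩ else 0

section ExtendIndex

variable {ι : Type*} [DecidableEq ι] {a : ι → ℕ} [∀ j, NeZero (a j)] {J : Finset ι}

lemma extendIndex_apply_coe (s : (j : J) → Fin (a j)) (j : J) : extendIndex J s j = s j := by
  simp [extendIndex]

lemma supportedIn_extendIndex (s : (j : J) → Fin (a j)) : SupportedIn J (extendIndex J s) := by
  intro j hj
  simp [extendIndex, hj]

lemma extendIndex_restrict {x : (j : ι) → Fin (a j)} (hx : SupportedIn J x) :
    extendIndex J (fun j => x j) = x := by
  funext j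
  by_cases hj : j ∈ J
  · simp [extendIndex, hj]
  · simp [extendIndex, hj, hx j hj]

lemma extendIndex_update (s : (j : J) → Fin (a j)) (l : J) (c : Fin (a l)) :
    extendIndex J (Function.update s l c) = Function.update (extendIndex J s) l c := by
  funext j
  obtain rfl | hj := eq_or_ne j l
  · simp [extendIndex]
  · by_cases hJ : j ∈ J
    · simp [extendIndex, hJ, hj, Subtype.ext_iff]
    · simp [extendIndex, hJ, hj]

end ExtendIndex

lemma swapIdeal_eq_segreIdeal {R : Type*} [CommRing R] {ι : Type*} [DecidableEq ι] {a : ι → ℕ}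
    [∀ j, NeZero (a j)] (J : Finset ι) :
    swapIdeal R (fun j => Fin (a j)) J = segreIdeal fun s => X (extendIndex J s) := by
  have tableMinor_X_extendIndex (l : J) (s t : (j : J) → Fin (a j)) :
      tableMinor (fun s => X (R := R) (extendIndex J s)) l s t =
        X (extendIndex J s) * X (extendIndex J t) -
          X (Function.update (extendIndex J s) l (extendIndex J t l)) *
            X (Function.update (extendIndex J t) l (extendIndex J s l)) := by
    simp only [tableMinor, Matrix.det_fin_two_of, extendIndex_update, extendIndex_apply_coe]
    ring
  refine le_antisymm (Ideal.span_le.2 ?_) (Ideal.span_le.2 ?_)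
  · rintro _ ⟨x, y, hx, hy, l, rfl⟩
    by_cases hl : l ∈ J
    · rw [← extendIndex_restrict hx, ← extendIndex_restrict hy]
      exact Ideal.subset_span ⟨⟨l, hl⟩, _, _, (tableMinor_X_extendIndex ⟨l, hl⟩ _ _).symm⟩
    · have hxy : x l = y l := (hx l hl).trans (hy l hl).symm
      simp [← hxy, hxy ▸ Function.update_eq_self l y]
  · rintro _ ⟨l, s, t, rfl⟩
    exact Ideal.subset_span ⟨_, _, supportedIn_extendIndex s, supportedIn_extendIndex t, l,
      tableMinor_X_extendIndex l s t⟩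

variable {n : ℕ} {a : Fin n → ℕ} {R : Type*} [CommRing R]

lemma tableAct_marginalTable {b : Fin n → ℕ} (J : Finset (Fin n))
    (U : (j : J) → Matrix (Fin (b j)) (Fin (a j)) ℤ) (A : ((j : Fin n) → Fin (a j)) → R)
    (s : (j : J) → Fin (b j)) :
    tableAct U (marginalTable A J) s = ∑ i, (∏ j : J, U j (s j) (i j)) • A i := by
  rw [← Finset.sum_fiberwise Finset.univ (fun (i : (j : Fin n) → Fin (a j)) (j : J) => i j)]
  refine Finset.sum_congr rfl fun t _ => ?_
  rw [marginalTable, Finset.smul_sum]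
  refine Finset.sum_congr (by simp only [funext_iff]) fun i hi => ?_
  have hit : ∀ j : J, i j = t j := by simpa [funext_iff] using hi
  simp only [hit]

/- Summing the entries along a coordinate outside `J` means selecting there the row of ones. -/
lemma tableAct_extendIndex [∀ j, NeZero (a j)] {U : (j : Fin n) → Matrix (Fin (a j)) (Fin (a j)) ℤ}
    (hU : ∀ j k, U j 0 k = 1) (A : ((j : Fin n) → Fin (a j)) → R) (J : Finset (Fin n))
    (s : (j : J) → Fin (a j)) :
    tableAct U A (extendIndex J s) = tableAct (fun j : J => U j) (marginalTable A J) s := by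
  rw [tableAct_marginalTable]
  refine Finset.sum_congr rfl fun i _ => ?_
  congr 1
  rw [← Finset.prod_subset (Finset.subset_univ J), ← Finset.prod_coe_sort]
  · simp only [extendIndex_apply_coe]
  · intro j _ hj
    rw [supportedIn_extendIndex s j hj, hU]

lemma independenceIdeal_X_eq_map_iSup_swapIdeal [∀ j, NeZero (a j)]
    {U W : (j : Fin n) → Matrix (Fin (a j)) (Fin (a j)) ℤ} (hUW : ∀ j, U j * W j = 1)
    (hU : ∀ j k, U j 0 k = 1) (Δ : Set (Finset (Fin n))) :
    independenceIdeal Δ (X : _ → MvPolynomial ((j : Fin n) → Fin (a j)) R) =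
      (⨆ J ∈ Δ, swapIdeal R (fun j => Fin (a j)) J).map (tableActEquiv R hUW) := by
  simp only [independenceIdeal, Ideal.map_iSup, swapIdeal_eq_segreIdeal, segreIdeal_map]
  refine biSup_congr fun J _ => ?_
  rw [← segreIdeal_tableAct (fun j : J => mul_eq_one_comm.1 (hUW j))]
  congr 1
  funext s
  rw [← tableAct_extendIndex hU]
  exact (tableActEquiv_X hUW _).symm

lemma independenceIdeal_eq_bot_of_isEmpty [IsEmpty ((j : Fin n) → Fin (a j))]
    (Δ : Set (Finset (Fin n))) (A : ((j : Fin n) → Fin (a j)) → R) :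
    independenceIdeal Δ A = ⊥ := by
  refine eq_bot_iff.2 (iSup₂_le fun J _ => Ideal.span_le.2 ?_)
  rintro _ ⟨l, i, k, rfl⟩
  simp [tableMinor, marginalTable]

end Margins

theorem mainTheorem3_general {R : Type*} [CommRing R] [IsReduced R] {n : ℕ} (a : Fin n → ℕ)
    (Δ : Set (Finset (Fin n))) (hfacets : (facets Δ).ncard ≤ 3) :
    (independenceIdeal Δ
      (MvPolynomial.X : _ → MvPolynomial ((j : Fin n) → Fin (a j)) R)).IsRadical := by
  obtain hempty | hnonempty := isEmpty_or_nonempty ((j : Fin n) → Fin (a j))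
  · rw [independenceIdeal_eq_bot_of_isEmpty]
    exact Ideal.isRadical_bot
  · have (j : Fin n) : NeZero (a j) := ⟨Fin.pos (hnonempty.some j) |>.ne'⟩
    have hswap : (⨆ J ∈ Δ, swapIdeal R (fun j => Fin (a j)) J).IsRadical := by
      rw [← iSup_swapIdeal_maximal]
      exact isRadical_iSup_swapIdeal hfacets
    rw [independenceIdeal_X_eq_map_iSup_swapIdeal
      (fun j => Matrix.mul_nonsing_inv (marginMatrix (a j)) (by simp [det_marginMatrix]))
      (fun j => by simp [marginMatrix]),
      ← Ideal.comap_symm]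
    exact hswap.comap _

theorem mainTheorem3 {K : Type*} [Field K] (n : ℕ) (a : Fin n → ℕ)
    (Δ : Set (Finset (Fin n))) (hΔ : IsLowerSet Δ) (hfacets : (facets Δ).ncard ≤ 3) :
    (independenceIdeal Δ (genericTable K a)).IsRadical :=
  mainTheorem3_general a Δ hfacets
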